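/- Let $\mathbb M=\mathbb N\times[0,1]$, let $\pi:\mathbb M\to\mathbb N$ be the projection $(n,x)\mapsto n$, let $\mathbb M^*=\beta\mathbb M\setminus\mathbb M$ and $\mathbb N^*=\beta\mathbb N\setminus\mathbb N$ be the Čech–Stone remainders, and let $\pi^*:\mathbb M^*\to\mathbb N^*$ be the restriction to $\mathbb M^*$ of the continuous extension $\beta\pi:\beta\mathbb M\to\beta\mathbb N$ of $\pi$. For $u\in\mathbb N^*$ put $\mathbb I_u=(\pi^*)^{-1}(u)$, and let $\bar 0_u\in\mathbb I_u$ be the limit in $\beta\mathbb M$ of the points $(n,0)$ along the ultrafilter $u$. For $x,y\in\mathbb I_u$ write $x\le_u y$ if every subcontinuum (compact connected subset) of $\mathbb I_u$ that contains $y$ and $\bar 0_u$ also contains $x$. An autohomeomorphism $H$ of $\mathbb M^*$ is called order-preserving if there is a permutation $\rho$ of $\mathbb N^*$ such that, for all $u\in\mathbb N^*$, $H[\mathbb I_u]=\mathbb I_{\rho(u)}$, and $x\le_u y$ implies $H(x)\le_{\rho(u)}H(y)$ for all $x,y\in\mathbb I_u$. Theorem. Assume the Continuum Hypothesis. Then for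 every autohomeomorphism $h$ of $\mathbb N^*$ there is an autohomeomorphism $H$ of $\mathbb M^*$ such that $\pi^*\circ H=h\circ\pi^*$; moreover, $H$ can be chosen to be order-preserving. -/

import Mathlib

open scoped unitInterval

/-- The Čech–Stone remainder `X* = βX \ X`, with the subspace topology of `βX`. -/
abbrev Remainder (X : Type) [TopologicalSpace X] : Type :=
  {p : StoneCech X // p ∉ Set.range (stoneCechUnit : X → StoneCech X)}

/-- The space `𝕄 = ℕ × [0,1]`, with the product topology (`ℕ` is discrete). -/
abbrev MSpace : Type := ℕ × I

theorem continuous_unit_fst :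
    Continuous (fun z : MSpace => (stoneCechUnit z.1 : StoneCech ℕ)) :=
  continuous_stoneCechUnit.comp continuous_fst

theorem continuous_unit_seq (x : ℕ → I) :
    Continuous (fun n : ℕ => (stoneCechUnit ((n, x n) : MSpace) : StoneCech MSpace)) :=
  continuous_of_discreteTopology

/-- The map `βπ : β𝕄 → βℕ`, the continuous extension of `π (n, x) = n`. -/
noncomputable def betaPi : StoneCech MSpace → StoneCech ℕ :=
  stoneCechExtend continuous_unit_fst

theorem betaPi_unit (z : MSpace) : betaPi (stoneCechUnit z) = stoneCechUnit z.1 :=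
  stoneCechExtend_stoneCechUnit continuous_unit_fst z

theorem continuous_betaPi : Continuous betaPi :=
  continuous_stoneCechExtend continuous_unit_fst

/-- `βπ` maps `𝕄*` into `ℕ*`, because the fibres of `π` are compact. -/
theorem betaPi_mem_remainder {p : StoneCech MSpace}
    (hp : p ∉ Set.range (stoneCechUnit : MSpace → StoneCech MSpace)) :
    betaPi p ∉ Set.range (stoneCechUnit : ℕ → StoneCech ℕ) := by
  rintro ⟨n, hn⟩
  apply hp
  have hf : Continuous (fun m : ℕ => decide (m = n)) := continuous_of_discreteTopology
  have hU : IsOpen ((stoneCechExtend hf ∘ betaPi) ⁻¹' {true}) :=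
    (isOpen_discrete _).preimage ((continuous_stoneCechExtend hf).comp continuous_betaPi)
  have hpU : p ∈ (stoneCechExtend hf ∘ betaPi) ⁻¹' {true} := by
    simp [← hn, stoneCechExtend_stoneCechUnit]
  have hcl : IsClosed ((stoneCechUnit : MSpace → StoneCech MSpace) '' ({n} ×ˢ Set.univ)) :=
    ((isCompact_singleton.prod isCompact_univ).image continuous_stoneCechUnit).isClosed
  have hmem := denseRange_stoneCechUnit.open_subset_closure_inter hU hpU
  have hsub : ((stoneCechExtend hf ∘ betaPi) ⁻¹' {true}) ∩
      Set.range (stoneCechUnit : MSpace → StoneCech MSpace) ⊆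
      (stoneCechUnit : MSpace → StoneCech MSpace) '' ({n} ×ˢ Set.univ) := by
    rintro _ ⟨hz, z, rfl⟩
    refine ⟨z, ?_, rfl⟩
    simpa [betaPi_unit, stoneCechExtend_stoneCechUnit] using hz
  obtain ⟨z, -, hz⟩ := hcl.closure_subset_iff.2 hsub hmem
  exact ⟨z, hz⟩

/-- The projection `π* : 𝕄* → ℕ*`, the restriction of `βπ`. -/
noncomputable def piStar (p : Remainder MSpace) : Remainder ℕ :=
  ⟨betaPi p.1, betaPi_mem_remainder p.2⟩

/-- The fibre `𝕀_u = (π*)⁻¹(u)` of `u ∈ ℕ*`. -/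
def fiber (u : Remainder ℕ) : Set (Remainder MSpace) := piStar ⁻¹' {u}

/-- For a sequence `x` in `[0,1]`, the extension to `βℕ` of `n ↦ (n, x n)`; its value at `u` is
the limit of the points `(n, x n)` of `β𝕄` along `u`. -/
noncomputable def betaSeq (x : ℕ → I) : StoneCech ℕ → StoneCech MSpace :=
  stoneCechExtend (continuous_unit_seq x)

theorem betaPi_betaSeq (x : ℕ → I) (u : StoneCech ℕ) : betaPi (betaSeq x u) = u := by
  have h : betaPi ∘ betaSeq x = id := by
    refine stoneCech_hom_ext
      (continuous_betaPi.comp (continuous_stoneCechExtend _)) continuous_id ?_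
    funext n
    simp [betaSeq, stoneCechExtend_stoneCechUnit, betaPi_unit]
  exact congrFun h u

theorem betaSeq_mem_remainder (x : ℕ → I) (u : Remainder ℕ) :
    betaSeq x u.1 ∉ Set.range (stoneCechUnit : MSpace → StoneCech MSpace) := by
  rintro ⟨z, hz⟩
  apply u.2
  exact ⟨z.1, by rw [← betaPi_unit, hz, betaPi_betaSeq]⟩

/-- The point `x̄_u = u-lim (n, x n)` of `𝕄*` (it lies in `𝕀_u`). -/
noncomputable def seqPoint (x : ℕ → I) (u : Remainder ℕ) : Remainder MSpace :=
  ⟨betaSeq x u.1, betaSeq_mem_remainder x u⟩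

/-- The end point `0̄_u` of `𝕀_u`. -/
noncomputable def zeroPoint (u : Remainder ℕ) : Remainder MSpace := seqPoint (fun _ => 0) u

/-- The quasi-order `≤_u` on `𝕀_u`: every subcontinuum (compact connected subset) of `𝕀_u` that
contains `y` and `0̄_u` also contains `x`. -/
def FiberLE (u : Remainder ℕ) (x y : Remainder MSpace) : Prop :=
  x ∈ fiber u ∧ y ∈ fiber u ∧
    ∀ K : Set (Remainder MSpace), K ⊆ fiber u → IsCompact K → IsConnected K →
      y ∈ K → zeroPoint u ∈ K → x ∈ K

/-- `H` is order-preserving: for the permutation `ρ` of `ℕ*` with `H[𝕀_u] = 𝕀_{ρ u}`,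
`x ≤_u y` implies `H x ≤_{ρ u} H y`. Such a `ρ` is unique, since the `𝕀_u` are nonempty and
pairwise disjoint. -/
def OrderPreserving (H : Remainder MSpace ≃ₜ Remainder MSpace) : Prop :=
  ∃ ρ : Equiv.Perm (Remainder ℕ),
    (∀ u, H '' fiber u = fiber (ρ u)) ∧
    ∀ u x y, FiberLE u x y → FiberLE (ρ u) (H x) (H y)

/-!
The space `𝕄*` is determined by the lattice of closed subsets of `𝕄` modulo the subsets of finitely
many fibres, that is, by the reduced power `X^ℕ / fin`, where `X` consists of the closed subsets of
`[0,1]`, with the relations that say whether an intersection is empty or a union is `[0,1]`; the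
autohomeomorphism `h` of `ℕ*` is, by duality, an automorphism of `P(ℕ)/fin`. The proof lifts this
automorphism to the reduced power and realises the lifting by a homeomorphism.

*Lifting.* For any structure `X` in a countable language, every formula with parameters in
`X^ℕ / fin` has a truth value in `P(ℕ)/fin`, namely the class of the set of indices at which it
holds. Two families of sequences are `Matched` if all their truth values correspond under `h`. A
matching of countable families extends to any further sequence, on either side
(`Matched.extend`): any finite number of the countably many demands on the new coordinate can be
met at almost all indices, since "some `x` meets them" is itself a formula, and a diagonal choice
then meets all demands modulo finite sets. Under the Continuum Hypothesis there are `ℵ₁` sequences,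
so a back-and-forth recursion of length `ω₁` matches all sequences with all sequences
(`exists_matched_enumeration`).

*Realisation.* Closed subsets of `𝕄` have traces on `𝕄*`; by normality of `𝕄` taking traces
commutes with finite unions and intersections, and a trace is empty exactly when the closed set
lives on finitely many fibres. Hence matched sequences of closed subsets of `[0,1]` give two
families of closed subsets of `𝕄*` with the same finite intersection pattern, and a compactness
argument produces a homeomorphism `H` that carries one to the other
(`exists_homeomorph_of_matching_closed`).

Matching the sets `A × [0,1]` gives `π* ∘ H = h ∘ π*`. The language has a symbol for `{0}`, so `H`
also maps each `0̄_u` to `0̄_{h u}`; as `≤_u` is defined in terms of the topology of `𝕀_u` and the point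
`0̄_u` only, `H` is order-preserving.
-/

/-! ### Building generic sets by transfinite recursion of length `ω₁` -/

/-- A finite-character property `Good` that can be extended, from any countable good set, to meet
any one of at most `ℵ₁` requirements `D r`, holds of a set that meets all of them. -/
theorem exists_good_meeting_all {T R : Type} (hR : Cardinal.mk R ≤ Cardinal.aleph 1)
    (Good : Set T → Prop) (hempty : Good ∅)
    (hmono : ∀ S S', S' ⊆ S → Good S → Good S')
    (hfin : ∀ S, (∀ s ⊆ S, s.Finite → Good s) → Good S) (D : R → Set T)
    (hstep : ∀ S, S.Countable → Good S → ∀ r, ∃ t ∈ D r, Good (insert t S)) :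
    ∃ S, Good S ∧ ∀ r, ∃ t ∈ S, t ∈ D r := by
  classical
  rcases isEmpty_or_nonempty R with hE | ⟨⟨r₀⟩⟩
  · exact ⟨∅, hempty, fun r => hE.elim r⟩
  obtain ⟨t₀, -, -⟩ := hstep ∅ Set.countable_empty hempty r₀
  let W := (Cardinal.aleph 1).ord.ToType
  have hRW : Cardinal.mk R ≤ Cardinal.mk W := by simpa [W] using hR
  obtain ⟨j⟩ := Cardinal.le_def _ _ |>.1 hRW
  have : Nonempty R := ⟨r₀⟩
  let e : W → R := Function.invFun j
  have he : ∀ r, e (j r) = r := Function.leftInverse_invFun j.injective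
  have hwf : WellFounded ((· < ·) : W → W → Prop) := wellFounded_lt
  let F : ∀ w : W, (∀ y, y < w → T) → T := fun w f =>
    if h : ∃ t ∈ D (e w), Good (insert t {x | ∃ y hy, f y hy = x}) then h.choose else t₀
  let t : W → T := hwf.fix F
  have ht : ∀ w, Good (t '' Set.Iio w) → t w ∈ D (e w) ∧ Good (t '' Set.Iic w) := by
    intro w hw
    have hset : {x | ∃ y, ∃ _ : y < w, t y = x} = t '' Set.Iio w := by
      ext x; simp
    have hc : (t '' Set.Iio w).Countable := by
      refine Set.Countable.image ?_ t
      have h1 : Cardinal.mk W = Cardinal.aleph 1 := by simp [W]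
      have h2 := Cardinal.mk_Iio_lt w (by rw [h1]; simp [W])
      have h3 := h2.trans_eq (h1.trans Cardinal.succ_aleph0.symm)
      rwa [Order.lt_succ_iff, Cardinal.le_aleph0_iff_set_countable] at h3
    have hex : ∃ x ∈ D (e w), Good (insert x {x | ∃ y, ∃ _ : y < w, t y = x}) := by
      rw [hset]; exact hstep _ hc hw _
    have htw : t w = hex.choose := by
      have : t w = F w (fun y _ => t y) := hwf.fix_eq F w
      rw [this]
      exact dif_pos hex
    have h2 := hex.choose_spec
    rw [← htw, hset] at h2
    refine ⟨h2.1, ?_⟩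
    rw [← Set.Iio_insert, Set.image_insert_eq]
    exact h2.2
  -- A finite subset of a union of an increasing family lies in one of its members.
  have hun : ∀ J : Set W, (∀ w ∈ J, Good (t '' Set.Iic w)) → Good (t '' J) := by
    intro J hJ
    refine hfin _ fun s hs hsf => ?_
    obtain ⟨u, huJ, hu, rfl⟩ := (Set.exists_subset_image_finite_and
      (p := fun s' => s' = s)).1 ⟨s, hs, hsf, rfl⟩
    rcases u.eq_empty_or_nonempty with rfl | hne
    · simpa using hempty
    · obtain ⟨m, hm, hmax⟩ := Set.exists_max_image u id hu hne
      exact hmono _ _ (Set.image_mono fun x hx => hmax x hx) (hJ m (huJ hm))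
  have hall : ∀ w, Good (t '' Set.Iio w) := by
    intro w
    induction w using hwf.induction with
    | _ w ih => exact hun _ fun v hv => (ht v (ih v hv)).2
  refine ⟨t '' Set.univ, hun _ fun w _ => (ht w (hall w)).2, fun r => ?_⟩
  refine ⟨t (j r), ⟨_, trivial, rfl⟩, ?_⟩
  have := (ht (j r) (hall _)).1
  rwa [he] at this

/-- Antitone conditions each of which holds at almost all `n` can be diagonalised: a slowly
growing number of them is satisfied at `n`. -/
theorem exists_diagonal (Q : ℕ → ℕ → Prop) (h0 : ∀ n, Q 0 n)
    (h : ∀ k, ∀ᶠ n in Filter.cofinite, Q k n) :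
    ∃ K : ℕ → ℕ, (∀ n, Q (K n) n) ∧ ∀ k, ∀ᶠ n in Filter.cofinite, k ≤ K n := by
  classical
  refine ⟨fun n => Nat.findGreatest (fun k => Q k n) n, fun n => ?_, fun k => ?_⟩
  · exact Nat.findGreatest_spec (P := fun k => Q k n) (Nat.zero_le n) (h0 n)
  · have hk : ∀ᶠ n in Filter.cofinite, k ≤ n := by
      rw [Nat.cofinite_eq_atTop]; exact Filter.eventually_ge_atTop k
    filter_upwards [h k, hk] with n h1 h2
    exact Nat.le_findGreatest h2 h1

/-! ### Isomorphisms of reduced powers over an automorphism of `P(ℕ)/fin` -/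

/-- An automorphism of the Boolean algebra `P(ℕ)/fin`, presented as the relation
"the class of `A` is mapped to the class of `B`" between subsets of `ℕ`. -/
structure ModFiniteIso (E : Set ℕ → Set ℕ → Prop) : Prop where
  compl : ∀ {A B}, E A B → E Aᶜ Bᶜ
  inter : ∀ {A B A' B'}, E A B → E A' B' → E (A ∩ A') (B ∩ B')
  finite_iff : ∀ {A B}, E A B → (A.Finite ↔ B.Finite)
  congr_left : ∀ {A A' B}, E A B → A =ᶠ[Filter.cofinite] A' → E A' B
  congr_right : ∀ {A B B'}, E A B → B =ᶠ[Filter.cofinite] B' → E A B'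
  total : ∀ A, ∃ B, E A B
  surj : ∀ B, ∃ A, E A B
  univ : E Set.univ Set.univ

namespace ModFiniteIso

variable {E : Set ℕ → Set ℕ → Prop}

theorem flip (hE : ModFiniteIso E) : ModFiniteIso (flip E) where
  compl h := hE.compl h
  inter h h' := hE.inter h h'
  finite_iff h := (hE.finite_iff h).symm
  congr_left h h' := hE.congr_right h h'
  congr_right h h' := hE.congr_left h h'
  total := hE.surj
  surj := hE.total
  univ := hE.univ

theorem iInter (hE : ModFiniteIso E) {ι : Type} [Finite ι] {A B : ι → Set ℕ}
    (h : ∀ i, E (A i) (B i)) : E (⋂ i, A i) (⋂ i, B i) := by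
  suffices ∀ s : Set ι, s.Finite → E (⋂ i ∈ s, A i) (⋂ i ∈ s, B i) by
    simpa using this Set.univ Set.finite_univ
  intro s hs
  induction s, hs using Set.Finite.induction_on with
  | empty => simpa using hE.univ
  | insert _ _ ih =>
    simp only [Set.biInter_insert]
    exact hE.inter (h _) ih

end ModFiniteIso

section Matching

variable {L : FirstOrder.Language.{0, 0}} {X : Type} [L.Structure X]

/-- The families `a` and `b` of sequences in the structure `X` have the same type over `E`: for
every formula, the set of indices where `a` satisfies it is mapped by `E` to the set of indices
where `b` does. -/
def Matched (L : FirstOrder.Language.{0, 0}) {X : Type} [L.Structure X]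
    (E : Set ℕ → Set ℕ → Prop) {J : Type} (a b : J → ℕ → X) : Prop :=
  ∀ φ : L.Formula J, E {n | φ.Realize fun j => a j n} {n | φ.Realize fun j => b j n}

variable {E : Set ℕ → Set ℕ → Prop}

theorem Matched.flip {J : Type} {a b : J → ℕ → X} (h : Matched L E a b) :
    Matched L (flip E) b a := fun φ => h φ

theorem Matched.comp {J J' : Type} {a b : J → ℕ → X} (h : Matched L E a b) (r : J' → J) :
    Matched L E (fun j => a (r j)) (fun j => b (r j)) := by
  intro φ
  simpa [FirstOrder.Language.Formula.realize_relabel, Function.comp_def] using h (φ.relabel r)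

theorem matched_of_finite {J : Type} {a b : J → ℕ → X}
    (h : ∀ s : Finset J, Matched L E (fun j : s => a j) (fun j : s => b j)) :
    Matched L E a b := by
  classical
  intro φ
  have key : ∀ v : J → X,
      FirstOrder.Language.Formula.Realize
        (φ.restrictFreeVar (id : φ.freeVarFinset → φ.freeVarFinset)) (fun j => v j) ↔
      φ.Realize v := fun v =>
    FirstOrder.Language.BoundedFormula.realize_restrictFreeVar v (by intro a; rfl)
  have := h φ.freeVarFinset (φ.restrictFreeVar id)
  have e1 : ∀ c : J → ℕ → X, {n | FirstOrder.Language.Formula.Realize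
      (φ.restrictFreeVar (id : φ.freeVarFinset → φ.freeVarFinset)) fun j => c j n} =
      {n | φ.Realize fun j => c j n} := fun c => Set.ext fun n => key fun j => c j n
  rw [e1 a, e1 b] at this
  exact this

theorem countable_formula [Countable L.Symbols] (J : Type) [Countable J] :
    Countable (L.Formula J) := by
  have h : Countable (Σ n, L.BoundedFormula J n) := by
    rw [← Cardinal.mk_le_aleph0_iff]
    refine FirstOrder.Language.BoundedFormula.card_le.trans ?_
    have h1 : Cardinal.mk J ≤ Cardinal.aleph0 := Cardinal.mk_le_aleph0
    have h2 : L.card ≤ Cardinal.aleph0 := Cardinal.mk_le_aleph0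
    simpa using Cardinal.add_le_aleph0.2 ⟨h1, h2⟩
  exact (sigma_mk_injective (i := 0) (β := fun n => L.BoundedFormula J n)).countable

/-- The extension step of the back-and-forth construction: the reduced power modulo the finite
sets is `ℵ₁`-saturated, over any automorphism of `P(ℕ)/fin`. -/
theorem Matched.extend [Countable L.Symbols] (hE : ModFiniteIso E) {J : Type} [Countable J]
    {a b : J → ℕ → X} (h : Matched L E a b) (f : ℕ → X) :
    ∃ g : ℕ → X, Matched L E (Sum.elim a fun _ : Unit => f) (Sum.elim b fun _ : Unit => g) := by
  classical
  have : Countable (L.Formula (J ⊕ Unit)) := countable_formula _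
  obtain ⟨φ, hφ⟩ := exists_surjective_nat (L.Formula (J ⊕ Unit))
  let A : ℕ → Set ℕ := fun k =>
    {n | (φ k).Realize (Sum.elim (fun j => a j n) fun _ => f n)}
  choose B hB using fun k => hE.total (A k)
  let Q : ℕ → ℕ → Prop := fun k n =>
    ∃ x, ∀ i < k, ((φ i).Realize (Sum.elim (fun j => b j n) fun _ => x) ↔ n ∈ B i)
  have hQ : ∀ k, ∀ᶠ n in Filter.cofinite, Q k n := by
    intro k
    -- `ψ s` says that some `x` has the pattern `s` of truth values on the first `k` formulas.
    let χ : Set (Fin k) → Fin k → L.Formula (J ⊕ Unit) := fun s i =>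
      if i ∈ s then φ i else (φ i).not
    let ψ : Set (Fin k) → L.Formula J := fun s =>
      (FirstOrder.Language.Formula.iInf (χ s)).iExs Unit
    have hψ : ∀ s (v : J → X), (ψ s).Realize v ↔
        ∃ x : X, ∀ i : Fin k, ((φ i).Realize (Sum.elim v fun _ => x) ↔ i ∈ s) := by
      intro s v
      simp only [ψ, FirstOrder.Language.Formula.realize_iExs,
        FirstOrder.Language.Formula.realize_iInf]
      have hχ : ∀ i (w : J ⊕ Unit → X), (χ s i).Realize w ↔ ((φ i).Realize w ↔ i ∈ s) := by
        intro i w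
        by_cases his : i ∈ s
        · simp [χ, his]
        · simp [χ, his, FirstOrder.Language.Formula.realize_not]
      simp only [hχ]
      exact ⟨fun ⟨x, hx⟩ => ⟨x (), hx⟩, fun ⟨x, hx⟩ => ⟨fun _ => x, hx⟩⟩
    let As : Set (Fin k) → Set ℕ := fun s => ⋂ i, if i ∈ s then A i else (A i)ᶜ
    let Bs : Set (Fin k) → Set ℕ := fun s => ⋂ i, if i ∈ s then B i else (B i)ᶜ
    have hAB : ∀ s, E (As s) (Bs s) := by
      intro s
      refine hE.iInter fun i => ?_
      split_ifs
      · exact hB i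
      · exact hE.compl (hB i)
    have hfin : ∀ s, (Bs s ∩ {n | (ψ s).Realize fun j => b j n}ᶜ).Finite := by
      intro s
      rw [← hE.finite_iff (hE.inter (hAB s) (hE.compl (h (ψ s))))]
      convert Set.finite_empty
      rw [Set.eq_empty_iff_forall_notMem]
      rintro n ⟨hn, hn'⟩
      refine hn' ((hψ _ _).2 ⟨f n, fun i => ?_⟩)
      have := Set.mem_iInter.1 hn i
      by_cases his : i ∈ s
      · simpa [his, A] using this
      · simpa [his, A] using this
    refine (Set.finite_iUnion hfin).subset ?_
    intro n hn
    let s : Set (Fin k) := {i | n ∈ B i}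
    refine Set.mem_iUnion.2 ⟨s, ?_, fun hc => hn ?_⟩
    · refine Set.mem_iInter.2 fun i => ?_
      by_cases his : n ∈ B i
      · rw [if_pos (show i ∈ s from his)]; exact his
      · rw [if_neg (show i ∉ s from his)]; exact his
    · obtain ⟨x, hx⟩ := (hψ _ _).1 hc
      exact ⟨x, fun i hi => hx ⟨i, hi⟩⟩
  obtain ⟨K, hK, hK'⟩ := exists_diagonal Q (fun n => ⟨f n, by simp⟩) hQ
  choose g hg using hK
  refine ⟨g, fun θ => ?_⟩
  obtain ⟨k, rfl⟩ := hφ θ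
  have e1 : ∀ (c : J → ℕ → X) (d : ℕ → X) (n : ℕ),
      (fun j => Sum.elim c (fun _ : Unit => d) j n) =
        Sum.elim (fun j => c j n) fun _ => d n := by
    intro c d n; ext j; cases j <;> rfl
  simp only [e1]
  refine hE.congr_right (hB k) ?_
  filter_upwards [hK' (k + 1)] with n hn
  exact propext (hg n k (by omega)).symm

/-- Under the Continuum Hypothesis every automorphism of `P(ℕ)/fin` lifts to an isomorphism of the
reduced power of any structure of size at most continuum in a countable language. The isomorphism
is given by two enumerations of all sequences, corresponding terms of which are matched. -/
theorem exists_matched_enumeration [Countable L.Symbols]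
    (CH : (Cardinal.aleph 1 : Cardinal.{0}) = Cardinal.continuum)
    (hX : Cardinal.mk X ≤ Cardinal.continuum) (hE : ModFiniteIso E) :
    ∃ (J : Type) (a b : J → ℕ → X), Matched L E a b ∧
      Function.Surjective a ∧ Function.Surjective b := by
  classical
  let T := (ℕ → X) × (ℕ → X)
  let Good : Set T → Prop := fun S =>
    Matched L E (fun p : S => p.1.1) (fun p : S => p.1.2)
  let D : (ℕ → X) ⊕ (ℕ → X) → Set T :=
    Sum.elim (fun f => {p | p.1 = f}) (fun g => {p | p.2 = g})
  have hcard : Cardinal.mk ((ℕ → X) ⊕ (ℕ → X)) ≤ Cardinal.aleph 1 := by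
    have : Cardinal.mk (ℕ → X) ≤ Cardinal.continuum := by
      rw [← Cardinal.power_def, Cardinal.mk_nat]
      refine (Cardinal.power_le_power_right hX).trans ?_
      simp
    rw [CH, ← Cardinal.add_def]
    exact (add_le_add this this).trans (by simp)
  have hins : ∀ (S : Set T) (f g : ℕ → X),
      Matched L E (Sum.elim (fun p : S => p.1.1) fun _ : Unit => f)
        (Sum.elim (fun p : S => p.1.2) fun _ : Unit => g) → Good (insert (f, g) S) := by
    intro S f g h
    let r : (insert (f, g) S : Set T) → S ⊕ Unit := fun p =>
      if hp : p.1 ∈ S then Sum.inl ⟨p.1, hp⟩ else Sum.inr ()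
    have := h.comp r
    convert this using 1
    · ext p n
      by_cases hp : p.1 ∈ S
      · simp [r, hp]
      · rw [show r p = Sum.inr () from dif_neg hp, p.2.resolve_right hp]; rfl
    · ext p n
      by_cases hp : p.1 ∈ S
      · simp [r, hp]
      · rw [show r p = Sum.inr () from dif_neg hp, p.2.resolve_right hp]; rfl
  have hempty : Good ∅ := by
    intro φ
    -- Without free variables the set of indices does not depend on the sequences.
    have : IsEmpty (∅ : Set T) := Set.isEmpty_coe_sort.2 rfl
    have hv : ∀ v w : (∅ : Set T) → X, v = w := fun v w => Subsingleton.elim v w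
    by_cases hφ : φ.Realize (fun p : (∅ : Set T) => isEmptyElim p : (∅ : Set T) → X)
    · have : ∀ v : (∅ : Set T) → X, φ.Realize v := fun v => hv _ v ▸ hφ
      simpa [this] using hE.univ
    · have : ∀ v : (∅ : Set T) → X, ¬ φ.Realize v := fun v => hv _ v ▸ hφ
      simpa [this] using hE.compl hE.univ
  obtain ⟨S, hS, hSD⟩ := exists_good_meeting_all hcard Good hempty
    (fun S S' hSS (h : Matched L E _ _) => h.comp (Set.inclusion hSS))
    (by
      intro S h
      refine matched_of_finite fun s => ?_
      have : Matched L E _ _ := h (Subtype.val '' (s : Set S)) (by simp) (s.finite_toSet.image _)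
      exact this.comp fun j : s => ⟨j.1.1, ⟨j.1, j.2, rfl⟩⟩)
    D
    (by
      intro S hSc h r
      have : Countable S := hSc.to_subtype
      rcases r with f | g
      · obtain ⟨g, hg⟩ := Matched.extend hE h f
        exact ⟨(f, g), rfl, hins _ _ _ hg⟩
      · obtain ⟨f, hf⟩ := Matched.extend hE.flip h.flip g
        exact ⟨(f, g), rfl, hins _ _ _ hf.flip⟩)
  refine ⟨S, fun p => p.1.1, fun p => p.1.2, hS, fun f => ?_, fun g => ?_⟩
  · obtain ⟨t, htS, ht⟩ := hSD (Sum.inl f)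
    exact ⟨⟨t, htS⟩, ht⟩
  · obtain ⟨t, htS, ht⟩ := hSD (Sum.inr g)
    exact ⟨⟨t, htS⟩, ht⟩

end Matching

/-! ### A homeomorphism from two matching families of closed sets -/

section MatchingClosedSets

variable {K K' ι : Type} [TopologicalSpace K] [TopologicalSpace K'] [CompactSpace K']

/-- `H x` is the only point in the intersection of the sets `c' i` with `x ∈ c i`; there is one by
compactness of `K'`, and `hsep` yields uniqueness in a form that makes the graph of `H` closed. -/
theorem exists_continuous_of_matching_closed {c : ι → Set K} {c' : ι → Set K'}
    (hc : ∀ i, IsClosed (c i)) (hc' : ∀ i, IsClosed (c' i))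
    (hfip : ∀ s : Finset ι, (⋂ i ∈ s, c i).Nonempty → (⋂ i ∈ s, c' i).Nonempty)
    (hsep : ∀ x y : K', x ≠ y →
      ∃ i j, x ∉ c' i ∧ y ∉ c' j ∧ c i ∪ c j = Set.univ) :
    ∃ H : K → K', Continuous H ∧ ∀ x i, x ∈ c i → H x ∈ c' i := by
  classical
  have hex : ∀ x, ∃ y, ∀ i, x ∈ c i → y ∈ c' i := by
    intro x
    have : (⋂ i : {i // x ∈ c i}, c' i).Nonempty := by
      by_contra hne
      rw [Set.not_nonempty_iff_eq_empty] at hne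
      obtain ⟨t, ht⟩ := isCompact_univ.elim_finite_subfamily_closed
        (fun i : {i // x ∈ c i} => c' i) (fun i => hc' i) (by rw [hne]; simp)
      rw [Set.univ_inter] at ht
      obtain ⟨y, hy⟩ := hfip (t.image Subtype.val)
        ⟨x, by simp only [Set.mem_iInter, Finset.mem_image]; rintro _ ⟨i, -, rfl⟩; exact i.2⟩
      refine Set.notMem_empty y (ht ▸ ?_)
      simp only [Set.mem_iInter] at hy ⊢
      exact fun i hi => hy i (Finset.mem_image_of_mem _ hi)
    obtain ⟨y, hy⟩ := this
    exact ⟨y, fun i hi => Set.mem_iInter.1 hy ⟨i, hi⟩⟩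
  choose H hH using hex
  refine ⟨H, ?_, hH⟩
  -- The graph of `H` is closed, which suffices as `K'` is compact.
  have hgraph : IsClosed {z : K × K' | H z.1 = z.2} := by
    rw [← isOpen_compl_iff, isOpen_iff_forall_mem_open]
    rintro ⟨x, y⟩ hxy
    obtain ⟨i, j, h1, h2, h3⟩ := hsep _ _ hxy
    refine ⟨(c i)ᶜ ×ˢ (c' j)ᶜ, ?_, (hc i).isOpen_compl.prod (hc' j).isOpen_compl,
      fun h => h1 (hH _ _ h), h2⟩
    rintro ⟨x', y'⟩ ⟨hx', hy'⟩ (heq : H x' = y')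
    have hx : x' ∈ c j := (h3 ▸ Set.mem_univ x' : x' ∈ c i ∪ c j).resolve_left hx'
    exact hy' (heq ▸ hH _ _ hx)
  refine continuous_iff_isClosed.2 fun C hC => ?_
  have := isClosedMap_fst_of_compactSpace (X := K) (Y := K') _
    (hgraph.inter (hC.preimage continuous_snd))
  convert this using 1
  ext x
  simp

/-- Let `c` and `c'` be equally indexed families of closed sets of compact spaces `K` and `K'`. If
corresponding finite subfamilies have the finite intersection property simultaneously, and points
of each space are separated by pairs of members whose unions cover in both spaces, then there is a
homeomorphism that takes `c i` to `c' i` for all `i`. -/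
theorem exists_homeomorph_of_matching_closed [CompactSpace K] {c : ι → Set K} {c' : ι → Set K'}
    (hc : ∀ i, IsClosed (c i)) (hc' : ∀ i, IsClosed (c' i))
    (hfip : ∀ s : Finset ι, (⋂ i ∈ s, c i).Nonempty ↔ (⋂ i ∈ s, c' i).Nonempty)
    (hsep : ∀ x y : K, x ≠ y →
      ∃ i j, x ∉ c i ∧ y ∉ c j ∧ c i ∪ c j = Set.univ ∧ c' i ∪ c' j = Set.univ)
    (hsep' : ∀ x y : K', x ≠ y →
      ∃ i j, x ∉ c' i ∧ y ∉ c' j ∧ c i ∪ c j = Set.univ ∧ c' i ∪ c' j = Set.univ) :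
    ∃ H : K ≃ₜ K', ∀ x i, H x ∈ c' i ↔ x ∈ c i := by
  obtain ⟨H, hHc, hH⟩ := exists_continuous_of_matching_closed hc hc' (fun s => (hfip s).1)
    fun x y hxy => by
      obtain ⟨i, j, h1, h2, h3, -⟩ := hsep' x y hxy
      exact ⟨i, j, h1, h2, h3⟩
  obtain ⟨G, hGc, hG⟩ := exists_continuous_of_matching_closed hc' hc (fun s => (hfip s).2)
    fun x y hxy => by
      obtain ⟨i, j, h1, h2, -, h3⟩ := hsep x y hxy
      exact ⟨i, j, h1, h2, h3⟩
  have hGH : ∀ x, G (H x) = x := by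
    intro x
    by_contra hne
    obtain ⟨i, j, h1, h2, h3, -⟩ := hsep _ _ hne
    rcases h3 ▸ Set.mem_univ x with h | h
    · exact h1 (hG _ _ (hH _ _ h))
    · exact h2 h
  have hHG : ∀ x, H (G x) = x := by
    intro x
    by_contra hne
    obtain ⟨i, j, h1, h2, -, h3⟩ := hsep' _ _ hne
    rcases h3 ▸ Set.mem_univ x with h | h
    · exact h1 (hH _ _ (hG _ _ h))
    · exact h2 h
  refine ⟨⟨⟨H, G, hGH, hHG⟩, hHc, hGc⟩, fun x i => ⟨fun h => ?_, hH x i⟩⟩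
  exact hGH x ▸ hG (H x) i h

end MatchingClosedSets

/-! ### Traces of closed sets on the Čech–Stone remainder -/

section Trace

variable {X : Type} [TopologicalSpace X]

/-- The trace on `X*` of the closure in `βX` of a subset `F` of `X`. -/
def remTrace (F : Set X) : Set (Remainder X) :=
  {p | p.1 ∈ closure ((stoneCechUnit : X → StoneCech X) '' F)}

theorem isClosed_remTrace (F : Set X) : IsClosed (remTrace F) :=
  isClosed_closure.preimage continuous_subtype_val

theorem remTrace_mono {F G : Set X} (h : F ⊆ G) : remTrace F ⊆ remTrace G :=
  fun _ hp => closure_mono (Set.image_mono h) hp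

theorem remTrace_union (F G : Set X) : remTrace (F ∪ G) = remTrace F ∪ remTrace G := by
  ext p
  simp [remTrace, Set.image_union, closure_union]

theorem remTrace_univ : remTrace (Set.univ : Set X) = Set.univ := by
  ext p
  simpa [remTrace] using denseRange_stoneCechUnit p.1

theorem remTrace_eq_empty_of_isCompact {F : Set X} (hF : IsCompact F) : remTrace F = ∅ := by
  rw [Set.eq_empty_iff_forall_notMem]
  intro p hp
  have hcl := (hF.image continuous_stoneCechUnit).isClosed
  simp only [remTrace, hcl.closure_eq, Set.mem_ofPred_eq] at hp
  exact p.2 (Set.image_subset_range _ _ hp)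

theorem disjoint_closure_stoneCechUnit_image [NormalSpace X] {F G : Set X} (hF : IsClosed F)
    (hG : IsClosed G) (h : Disjoint F G) :
    Disjoint (closure ((stoneCechUnit : X → StoneCech X) '' F))
      (closure ((stoneCechUnit : X → StoneCech X) '' G)) := by
  obtain ⟨f, hf0, hf1, hf⟩ := exists_continuous_zero_one_of_isClosed hF hG h
  have hc : Continuous (fun x => (⟨f x, hf x⟩ : I)) := f.continuous.subtype_mk _
  have hg := continuous_stoneCechExtend hc
  have h0 : closure ((stoneCechUnit : X → StoneCech X) '' F) ⊆ stoneCechExtend hc ⁻¹' {0} := by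
    refine closure_minimal ?_ (isClosed_singleton.preimage hg)
    rintro _ ⟨x, hx, rfl⟩
    simpa [stoneCechExtend_stoneCechUnit, Subtype.ext_iff] using hf0 hx
  have h1 : closure ((stoneCechUnit : X → StoneCech X) '' G) ⊆ stoneCechExtend hc ⁻¹' {1} := by
    refine closure_minimal ?_ (isClosed_singleton.preimage hg)
    rintro _ ⟨x, hx, rfl⟩
    simpa [stoneCechExtend_stoneCechUnit, Subtype.ext_iff] using hf1 hx
  refine Set.disjoint_left.2 fun p hp hp' => ?_
  have e0 : stoneCechExtend hc p = 0 := h0 hp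
  have e1 : stoneCechExtend hc p = 1 := h1 hp'
  exact zero_ne_one (e0.symm.trans e1)

theorem disjoint_remTrace [NormalSpace X] {F G : Set X} (hF : IsClosed F) (hG : IsClosed G)
    (h : Disjoint F G) : Disjoint (remTrace F) (remTrace G) :=
  (disjoint_closure_stoneCechUnit_image hF hG h).preimage _

/-- A continuous function on `βX` that separates two closed sets cuts `X` into two closed pieces
whose closures avoid one of these sets each. -/
theorem exists_closed_cover_of_disjoint {C D : Set (StoneCech X)} (hC : IsClosed C)
    (hD : IsClosed D) (h : Disjoint C D) :
    ∃ F G : Set X, IsClosed F ∧ IsClosed G ∧ F ∪ G = Set.univ ∧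
      Disjoint (closure (stoneCechUnit '' F)) C ∧ Disjoint (closure (stoneCechUnit '' G)) D := by
  obtain ⟨f, hf0, hf1, -⟩ := exists_continuous_zero_one_of_isClosed hC hD h
  have hfu : Continuous fun x : X => f (stoneCechUnit x) :=
    f.continuous.comp continuous_stoneCechUnit
  refine ⟨{x | 1 / 2 ≤ f (stoneCechUnit x)}, {x | f (stoneCechUnit x) ≤ 1 / 2},
    isClosed_le continuous_const hfu, isClosed_le hfu continuous_const, ?_, ?_, ?_⟩
  · ext x; simpa using le_total _ _
  · have : closure (stoneCechUnit '' {x : X | 1 / 2 ≤ f (stoneCechUnit x)}) ⊆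
        {p | 1 / 2 ≤ f p} := by
      refine closure_minimal ?_ (isClosed_le continuous_const f.continuous)
      rintro _ ⟨x, hx, rfl⟩; exact hx
    refine Set.disjoint_left.2 fun p hp hp' => ?_
    have h1 : 1 / 2 ≤ f p := this hp
    rw [hf0 hp'] at h1
    norm_num at h1
  · have : closure (stoneCechUnit '' {x : X | f (stoneCechUnit x) ≤ 1 / 2}) ⊆
        {p | f p ≤ 1 / 2} := by
      refine closure_minimal ?_ (isClosed_le f.continuous continuous_const)
      rintro _ ⟨x, hx, rfl⟩; exact hx
    refine Set.disjoint_left.2 fun p hp hp' => ?_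
    have h1 : f p ≤ 1 / 2 := this hp
    rw [hf1 hp'] at h1
    norm_num at h1

theorem exists_remTrace_cover_of_disjoint [CompactSpace (Remainder X)] {C D : Set (Remainder X)}
    (hC : IsClosed C) (hD : IsClosed D) (h : Disjoint C D) :
    ∃ F G : Set X, IsClosed F ∧ IsClosed G ∧ F ∪ G = Set.univ ∧
      Disjoint (remTrace F) C ∧ Disjoint (remTrace G) D := by
  obtain ⟨F, G, hF, hG, hFG, h1, h2⟩ := exists_closed_cover_of_disjoint
    (hC.isCompact.image continuous_subtype_val).isClosed
    (hD.isCompact.image continuous_subtype_val).isClosed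
    ((Set.disjoint_image_iff Subtype.val_injective).2 h)
  exact ⟨F, G, hF, hG, hFG,
    Set.disjoint_left.2 fun p hp hp' => Set.disjoint_left.1 h1 hp (Set.mem_image_of_mem _ hp'),
    Set.disjoint_left.2 fun p hp hp' => Set.disjoint_left.1 h2 hp (Set.mem_image_of_mem _ hp')⟩

theorem remTrace_inter [NormalSpace X] {F G : Set X} (hF : IsClosed F) (hG : IsClosed G) :
    remTrace (F ∩ G) = remTrace F ∩ remTrace G := by
  refine Set.Subset.antisymm (Set.subset_inter (remTrace_mono Set.inter_subset_left)
    (remTrace_mono Set.inter_subset_right)) ?_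
  rintro p ⟨hpF, hpG⟩
  by_contra hp
  obtain ⟨A, B, hA, hB, hAB, h1, h2⟩ := exists_closed_cover_of_disjoint
    (C := {p.1}) isClosed_singleton isClosed_closure (Set.disjoint_singleton_left.2 hp)
  -- `B` is a neighbourhood of `p` in which `F` and `G` are disjoint.
  have hloc : ∀ {F : Set X}, p ∈ remTrace F → p ∈ remTrace (F ∩ B) := by
    intro F hpF
    have : F ⊆ A ∪ (F ∩ B) := by
      intro x hx
      rcases hAB ▸ Set.mem_univ x with h | h
      · exact Or.inl h
      · exact Or.inr ⟨hx, h⟩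
    have := remTrace_mono this hpF
    rw [remTrace_union] at this
    exact this.resolve_left fun h => Set.disjoint_left.1 h1 h rfl
  refine Set.disjoint_left.1 (disjoint_remTrace (hF.inter hB) (hG.inter hB) ?_)
    (hloc hpF) (hloc hpG)
  refine Set.disjoint_left.2 fun x hx hx' => Set.disjoint_left.1 h2
    (subset_closure (Set.mem_image_of_mem _ hx.2))
    (subset_closure (Set.mem_image_of_mem _ ⟨hx.1, hx'.1⟩))

theorem remTrace_biInter [NormalSpace X] {ι : Type} (s : Finset ι) {F : ι → Set X}
    (hF : ∀ i, IsClosed (F i)) : remTrace (⋂ i ∈ s, F i) = ⋂ i ∈ s, remTrace (F i) := by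
  classical
  induction s using Finset.induction_on with
  | empty => simp [remTrace_univ]
  | insert i s _ ih =>
    rw [Finset.set_biInter_insert, Finset.set_biInter_insert,
      remTrace_inter (hF i) (isClosed_iInter fun j => isClosed_iInter fun _ => hF j), ih]

theorem isOpen_stoneCechUnit_image {U : Set X} (hU : IsClopen U) (hUc : IsCompact U) :
    IsOpen ((stoneCechUnit : X → StoneCech X) '' U) := by
  classical
  have hf : Continuous (fun x => decide (x ∈ U)) := by
    rw [continuous_bool_rng true]
    simpa [Set.preimage] using hU
  have hV : IsOpen (stoneCechExtend hf ⁻¹' {true}) :=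
    (isOpen_discrete _).preimage (continuous_stoneCechExtend hf)
  have hcl := (hUc.image continuous_stoneCechUnit).isClosed
  convert hV using 1
  refine Set.Subset.antisymm ?_ ?_
  · rintro _ ⟨x, hx, rfl⟩
    simpa [stoneCechExtend_stoneCechUnit] using hx
  · intro p hp
    have := denseRange_stoneCechUnit.open_subset_closure_inter hV hp
    refine hcl.closure_subset_iff.2 ?_ this
    rintro _ ⟨hx, x, rfl⟩
    exact ⟨x, by simpa [stoneCechExtend_stoneCechUnit] using hx, rfl⟩

theorem compactSpace_remainder (h : ∀ x : X, ∃ U, x ∈ U ∧ IsClopen U ∧ IsCompact U) :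
    CompactSpace (Remainder X) := by
  have ho : IsOpen (Set.range (stoneCechUnit : X → StoneCech X)) := by
    rw [isOpen_iff_forall_mem_open]
    rintro _ ⟨x, rfl⟩
    obtain ⟨U, hx, hU, hUc⟩ := h x
    exact ⟨_, Set.image_subset_range _ _, isOpen_stoneCechUnit_image hU hUc,
      Set.mem_image_of_mem _ hx⟩
  exact isCompact_iff_compactSpace.1 ho.isClosed_compl.isCompact

end Trace

/-! ### The remainder of `ℕ` -/

instance compactSpace_remainder_nat : CompactSpace (Remainder ℕ) :=
  compactSpace_remainder fun n => ⟨{n}, rfl, isClopen_discrete _, isCompact_singleton⟩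

theorem remTrace_compl (A : Set ℕ) : remTrace Aᶜ = (remTrace A)ᶜ := by
  refine Set.eq_of_subset_of_subset ?_ ?_
  · exact (disjoint_remTrace (isClosed_discrete A) (isClosed_discrete Aᶜ)
      disjoint_compl_right).subset_compl_left
  · rw [Set.compl_subset_iff_union, ← remTrace_union, Set.union_compl_self, remTrace_univ]

theorem remTrace_eq_empty_iff_finite {A : Set ℕ} : remTrace A = ∅ ↔ A.Finite := by
  refine ⟨fun h => ?_, fun h => remTrace_eq_empty_of_isCompact h.isCompact⟩
  have hsub : closure ((stoneCechUnit : ℕ → StoneCech ℕ) '' A) ⊆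
      ⋃ n : ℕ, (stoneCechUnit : ℕ → StoneCech ℕ) '' {n} := by
    intro p hp
    by_contra hn
    refine (Set.eq_empty_iff_forall_notMem.1 h) ⟨p, ?_⟩ hp
    rintro ⟨n, rfl⟩
    exact hn (Set.mem_iUnion.2 ⟨n, n, rfl, rfl⟩)
  obtain ⟨t, ht⟩ := isClosed_closure.isCompact.elim_finite_subcover _
    (fun n => isOpen_stoneCechUnit_image (isClopen_discrete {n}) isCompact_singleton) hsub
  refine t.finite_toSet.subset fun n hn => ?_
  have := ht (subset_closure (Set.mem_image_of_mem _ hn))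
  simp only [Set.image_singleton, Set.mem_iUnion, Set.mem_singleton_iff] at this
  obtain ⟨m, hm, hnm⟩ := this
  have hid : n = m := injective_stoneCechUnit_of_t35Space hnm
  exact hid ▸ hm

theorem remTrace_subset_of_eventuallyEq {A B : Set ℕ} (h : A =ᶠ[Filter.cofinite] B) :
    remTrace A ⊆ remTrace B := by
  have h1 : (A \ B).Finite := by
    refine Set.Finite.subset h ?_
    rintro n ⟨hA, hB⟩ (hn : A n = B n)
    exact hB (show B n from hn ▸ hA)
  have h2 : A ⊆ B ∪ (A \ B) := by simp
  have h3 := remTrace_mono h2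
  rwa [remTrace_union, remTrace_eq_empty_iff_finite.2 h1, Set.union_empty] at h3

theorem remTrace_congr {A B : Set ℕ} (h : A =ᶠ[Filter.cofinite] B) : remTrace A = remTrace B :=
  (remTrace_subset_of_eventuallyEq h).antisymm (remTrace_subset_of_eventuallyEq h.symm)

/-- Every clopen subset of `ℕ*` comes from a subset of `ℕ`; this is how a homeomorphism of `ℕ*` acts
on `P(ℕ)/fin`. -/
theorem exists_remTrace_eq_of_isClopen {C : Set (Remainder ℕ)} (hC : IsClopen C) :
    ∃ A, remTrace A = C := by
  obtain ⟨F, G, -, -, hFG, h1, h2⟩ := exists_remTrace_cover_of_disjoint hC.isClosed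
    hC.compl.isClosed disjoint_compl_right
  refine ⟨G, Set.Subset.antisymm (Set.disjoint_compl_right_iff_subset.1 h2) fun p hp => ?_⟩
  have : p ∈ remTrace (F ∪ G) := by rw [hFG, remTrace_univ]; trivial
  rw [remTrace_union] at this
  exact this.resolve_left fun h => Set.disjoint_left.1 h1 h hp

theorem isClopen_remTrace (A : Set ℕ) : IsClopen (remTrace A) := by
  refine ⟨isClosed_remTrace A, ?_⟩
  rw [← isClosed_compl_iff, ← remTrace_compl]
  exact isClosed_remTrace _

theorem eq_of_forall_mem_remTrace {u v : Remainder ℕ}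
    (h : ∀ A : Set ℕ, u ∈ remTrace A → v ∈ remTrace A) : u = v := by
  by_contra hne
  obtain ⟨F, G, -, -, hFG, h1, h2⟩ := exists_remTrace_cover_of_disjoint
    (isClosed_singleton (x := u)) (isClosed_singleton (x := v)) (by simpa using hne)
  have : u ∈ remTrace (F ∪ G) := by rw [hFG, remTrace_univ]; trivial
  rw [remTrace_union] at this
  rcases this with hu | hu
  · exact Set.disjoint_left.1 h1 hu rfl
  · exact Set.disjoint_left.1 h2 (h _ hu) rfl

/-- The relation between subsets of `ℕ` that an autohomeomorphism of `ℕ*` induces by duality. -/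
def dualRel (h : Remainder ℕ ≃ₜ Remainder ℕ) (A B : Set ℕ) : Prop :=
  ∀ u, h u ∈ remTrace B ↔ u ∈ remTrace A

theorem modFiniteIso_dualRel (h : Remainder ℕ ≃ₜ Remainder ℕ) : ModFiniteIso (dualRel h) where
  compl hAB u := by simp only [remTrace_compl, Set.mem_compl_iff, hAB u]
  inter hAB hAB' u := by
    simp only [remTrace_inter (isClosed_discrete _) (isClosed_discrete _), Set.mem_inter_iff,
      hAB u, hAB' u]
  finite_iff {A B} hAB := by
    rw [← remTrace_eq_empty_iff_finite, ← remTrace_eq_empty_iff_finite,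
      Set.eq_empty_iff_forall_notMem, Set.eq_empty_iff_forall_notMem,
      h.surjective.forall (p := fun v => v ∉ remTrace B)]
    exact forall_congr' fun u => not_congr (hAB u).symm
  congr_left hAB hA u := by rw [← remTrace_congr hA]; exact hAB u
  congr_right hAB hB u := by rw [← remTrace_congr hB]; exact hAB u
  total A := by
    obtain ⟨B, hB⟩ := exists_remTrace_eq_of_isClopen
      ((isClopen_remTrace A).preimage h.symm.continuous)
    exact ⟨B, fun u => by simp [hB]⟩
  surj B := by
    obtain ⟨A, hA⟩ := exists_remTrace_eq_of_isClopen ((isClopen_remTrace B).preimage h.continuous)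
    exact ⟨A, fun u => by simp [hA]⟩
  univ u := by simp [remTrace_univ]

/-! ### The remainder of `ℕ × [0,1]` -/

instance compactSpace_remainder_mspace : CompactSpace (Remainder MSpace) :=
  compactSpace_remainder fun z => ⟨{z.1} ×ˢ Set.univ, ⟨rfl, trivial⟩,
    (isClopen_discrete {z.1}).prod isClopen_univ, isCompact_singleton.prod isCompact_univ⟩

/-- The closed subset of `ℕ × [0,1]` with the given slices. -/
def ofSlices (F : ℕ → TopologicalSpace.Closeds I) : Set MSpace := {z | z.2 ∈ F z.1}

theorem isClosed_ofSlices (F : ℕ → TopologicalSpace.Closeds I) : IsClosed (ofSlices F) := by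
  have : ofSlices F = ⋂ n, (Prod.fst ⁻¹' {n}ᶜ ∪ Prod.snd ⁻¹' (F n : Set I)) := by
    ext z
    simp only [ofSlices, Set.mem_iInter, Set.mem_union, Set.mem_preimage, Set.mem_compl_iff,
      Set.mem_singleton_iff, SetLike.mem_coe, Set.mem_ofPred_eq]
    refine ⟨fun h n => ?_, fun h => (h z.1).resolve_left (not_not.2 rfl)⟩
    by_cases hn : z.1 = n
    · exact Or.inr (hn ▸ h)
    · exact Or.inl hn
  rw [this]
  exact isClosed_iInter fun n => ((isClosed_discrete _).preimage continuous_fst).union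
    ((F n).isClosed.preimage continuous_snd)

theorem exists_ofSlices_eq {F : Set MSpace} (hF : IsClosed F) : ∃ S, ofSlices S = F :=
  ⟨fun n => ⟨{t | (n, t) ∈ F}, hF.preimage (by fun_prop)⟩, rfl⟩

theorem betaPi_mem_closure {F : Set MSpace} {p : StoneCech MSpace}
    (hp : p ∈ closure (stoneCechUnit '' F)) :
    betaPi p ∈ closure (stoneCechUnit '' (Prod.fst '' F)) := by
  refine closure_mono ?_ (image_closure_subset_closure_image continuous_betaPi ⟨p, hp, rfl⟩)
  rintro _ ⟨_, ⟨z, hz, rfl⟩, rfl⟩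
  exact ⟨z.1, ⟨z, hz, rfl⟩, (betaPi_unit z).symm⟩

theorem remTrace_eq_empty_iff_finite_image_fst {F : Set MSpace} (hF : IsClosed F) :
    remTrace F = ∅ ↔ (Prod.fst '' F).Finite := by
  refine ⟨fun h => ?_, fun h => ?_⟩
  · rw [← remTrace_eq_empty_iff_finite, Set.eq_empty_iff_forall_notMem]
    intro u hu
    -- A point of the closure of the projection lifts, by compactness.
    have hcl : IsClosed (betaPi '' closure (stoneCechUnit '' F)) :=
      (isClosed_closure.isCompact.image continuous_betaPi).isClosed
    have hsub : (stoneCechUnit : ℕ → StoneCech ℕ) '' (Prod.fst '' F) ⊆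
        betaPi '' closure (stoneCechUnit '' F) := by
      rintro _ ⟨_, ⟨z, hz, rfl⟩, rfl⟩
      exact ⟨_, subset_closure (Set.mem_image_of_mem _ hz), betaPi_unit z⟩
    obtain ⟨p, hp, hpu⟩ := closure_minimal hsub hcl hu
    refine Set.eq_empty_iff_forall_notMem.1 h ⟨p, ?_⟩ hp
    rintro ⟨z, rfl⟩
    exact u.2 ⟨z.1, by rw [← hpu, betaPi_unit]⟩
  · have hc : IsCompact ((Prod.fst '' F) ×ˢ (Set.univ : Set I)) := h.isCompact.prod isCompact_univ
    exact remTrace_eq_empty_of_isCompact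
      (hc.of_isClosed_subset hF fun z hz => ⟨⟨z, hz, rfl⟩, trivial⟩)

/-- Inclusion on all but finitely many fibres suffices, as the omitted fibres are compact. -/
theorem remTrace_subset_of_cofinite {F G : Set MSpace}
    (h : ∀ᶠ n in Filter.cofinite, ∀ t, (n, t) ∈ F → (n, t) ∈ G) : remTrace F ⊆ remTrace G := by
  let N : Set ℕ := {n | ¬ ∀ t, (n, t) ∈ F → (n, t) ∈ G}
  have hN : N.Finite := h
  have h1 : F ⊆ G ∪ N ×ˢ Set.univ := by
    rintro ⟨n, t⟩ hz
    by_cases hn : n ∈ N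
    · exact Or.inr ⟨hn, trivial⟩
    · exact Or.inl (not_not.1 hn t hz)
  have h2 := remTrace_mono h1
  rwa [remTrace_union, remTrace_eq_empty_of_isCompact (hN.isCompact.prod isCompact_univ),
    Set.union_empty] at h2

/-- The trace of `A × [0,1]` is the part of `𝕄*` over the trace of `A`. -/
theorem mem_remTrace_preimage_fst {A : Set ℕ} {p : Remainder MSpace} :
    p ∈ remTrace (Prod.fst ⁻¹' A : Set MSpace) ↔ piStar p ∈ remTrace A := by
  have key : ∀ {B : Set ℕ}, p ∈ remTrace (Prod.fst ⁻¹' B : Set MSpace) →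
      piStar p ∈ remTrace B := fun {B} hp =>
    closure_mono (Set.image_mono (Set.image_preimage_subset _ _)) (betaPi_mem_closure hp)
  refine ⟨key, fun hp => ?_⟩
  have hu : p ∈ remTrace (Prod.fst ⁻¹' A ∪ Prod.fst ⁻¹' Aᶜ : Set MSpace) := by
    rw [← Set.preimage_union, Set.union_compl_self, Set.preimage_univ, remTrace_univ]; trivial
  rw [remTrace_union] at hu
  refine hu.resolve_right fun h => ?_
  have := key h
  rw [remTrace_compl] at this
  exact this hp

theorem zeroPoint_mem_fiber (u : Remainder ℕ) : zeroPoint u ∈ fiber u :=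
  Subtype.ext (betaPi_betaSeq _ u.1)

theorem zeroPoint_mem_remTrace (u : Remainder ℕ) :
    zeroPoint u ∈ remTrace {z : MSpace | z.2 = 0} := by
  have h : closure (Set.range (stoneCechUnit : ℕ → StoneCech ℕ)) ⊆
      betaSeq (fun _ => 0) ⁻¹' closure (stoneCechUnit '' {z : MSpace | z.2 = 0}) := by
    refine closure_minimal ?_ (isClosed_closure.preimage (continuous_stoneCechExtend _))
    rintro _ ⟨n, rfl⟩
    exact subset_closure ⟨(n, 0), rfl, by simp [betaSeq, stoneCechExtend_stoneCechUnit]⟩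
  exact h (denseRange_stoneCechUnit u.1)

theorem eq_zeroPoint_of_mem_remTrace {p : Remainder MSpace}
    (hp : p ∈ remTrace {z : MSpace | z.2 = 0}) : p = zeroPoint (piStar p) := by
  have hcl : IsClosed (Set.range (betaSeq fun _ => 0)) :=
    (isCompact_range (continuous_stoneCechExtend _)).isClosed
  have hsub : (stoneCechUnit : MSpace → StoneCech MSpace) '' {z : MSpace | z.2 = 0} ⊆
      Set.range (betaSeq fun _ => 0) := by
    rintro _ ⟨⟨n, t⟩, rfl, rfl⟩
    exact ⟨stoneCechUnit n, by simp [betaSeq, stoneCechExtend_stoneCechUnit]⟩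
  obtain ⟨v, hv⟩ := closure_minimal hsub hcl hp
  refine Subtype.ext ?_
  change p.1 = betaSeq _ (betaPi p.1)
  rw [← hv, betaPi_betaSeq]

/-! ### The closed subsets of `[0,1]` as a first-order structure -/

/-- The relational language with three relation symbols in each arity. -/
def closedsLanguage : FirstOrder.Language.{0, 0} := ⟨fun _ => Empty, fun _ => Fin 3⟩

instance : Countable closedsLanguage.Symbols := by
  have : IsEmpty (Σ n, closedsLanguage.Functions n) := ⟨fun x => Empty.elim x.2⟩
  have : Countable (Σ n, closedsLanguage.Relations n) :=
    inferInstanceAs (Countable (Σ _ : ℕ, Fin 3))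
  exact inferInstanceAs (Countable (_ ⊕ _))

/-- The three relations on closed subsets of `[0,1]`: having empty intersection, covering `[0,1]`,
and all being equal to `{0}`. -/
instance : closedsLanguage.Structure (TopologicalSpace.Closeds I) where
  funMap f := Empty.elim f
  RelMap {_} R F := ![⋂ i, (F i : Set I) = ∅, ⋃ i, (F i : Set I) = Set.univ,
    ∀ i, (F i : Set I) = {0}] R

theorem mk_closeds_le_continuum :
    Cardinal.mk (TopologicalSpace.Closeds I) ≤ Cardinal.continuum := by
  let 𝓑 := TopologicalSpace.countableBasis I
  have h𝓑 := TopologicalSpace.isBasis_countableBasis I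
  -- A closed set is determined by the basic open sets that it misses.
  let m : TopologicalSpace.Closeds I → Set 𝓑 := fun F => {U | Disjoint U.1 (F : Set I)}
  have hm : Function.Injective m := by
    have key : ∀ F G, m F = m G → (F : Set I) ⊆ G := by
      intro F G h x hx
      by_contra hxG
      obtain ⟨U, hU, hxU, hUG⟩ := h𝓑.exists_subset_of_mem_open
        (show x ∈ (G : Set I)ᶜ from hxG) G.isClosed.isOpen_compl
      have h1 : (⟨U, hU⟩ : 𝓑) ∈ m G := Set.subset_compl_iff_disjoint_right.1 hUG
      rw [← h] at h1
      exact Set.disjoint_left.1 h1 hxU hx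
    exact fun F G h => SetLike.coe_injective ((key F G h).antisymm (key G F h.symm))
  refine (Cardinal.mk_le_of_injective hm).trans ?_
  have h𝓑c : Cardinal.mk 𝓑 ≤ Cardinal.aleph0 := by
    have := TopologicalSpace.countable_countableBasis I
    exact (Cardinal.le_aleph0_iff_set_countable).2 this
  rw [Cardinal.mk_set, ← Cardinal.two_power_aleph0]
  exact Cardinal.power_le_power_left two_ne_zero h𝓑c

theorem Matched.rel {L : FirstOrder.Language.{0, 0}} {X : Type} [L.Structure X]
    {E : Set ℕ → Set ℕ → Prop} {J : Type} {a b : J → ℕ → X} (h : Matched L E a b) {k : ℕ}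
    (R : L.Relations k) (v : Fin k → J) :
    E {n | FirstOrder.Language.Structure.RelMap R fun i => a (v i) n}
      {n | FirstOrder.Language.Structure.RelMap R fun i => b (v i) n} := by
  simpa [FirstOrder.Language.Formula.realize_rel] using
    h (R.formula fun i => FirstOrder.Language.Term.var (v i))

section MatchedCloseds

variable {E : Set ℕ → Set ℕ → Prop} {J : Type} {a b : J → ℕ → TopologicalSpace.Closeds I}

theorem Matched.inter_eq_empty (h : Matched closedsLanguage E a b) (s : Finset J) :
    E {n | ⋂ j ∈ s, (a j n : Set I) = ∅} {n | ⋂ j ∈ s, (b j n : Set I) = ∅} := by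
  have := h.rel (k := s.card) (0 : Fin 3) fun i => (s.equivFin.symm i : J)
  have e : ∀ c : J → Set I, ⋂ i, c (s.equivFin.symm i) = ⋂ j ∈ s, c j := by
    intro c
    rw [s.equivFin.symm.surjective.iInter_comp fun j : s => c j, Set.iInter_subtype]
  have h0 : ∀ c : J → ℕ → TopologicalSpace.Closeds I,
      {n | ⋂ j ∈ s, (c j n : Set I) = ∅} =
      {n | ⋂ i, (c (s.equivFin.symm i) n : Set I) = ∅} := fun c => by
    ext n; simp only [Set.mem_ofPred_eq, e fun j => (c j n : Set I)]
  rw [h0 a, h0 b]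
  exact this

theorem Matched.union_eq_univ (h : Matched closedsLanguage E a b) (i j : J) :
    E {n | (a i n : Set I) ∪ a j n = Set.univ} {n | (b i n : Set I) ∪ b j n = Set.univ} := by
  have := h.rel (k := 2) (1 : Fin 3) ![i, j]
  have h0 : ∀ c : J → ℕ → TopologicalSpace.Closeds I,
      {n | (c i n : Set I) ∪ c j n = Set.univ} =
      {n | ⋃ k, (c (![i, j] k) n : Set I) = Set.univ} := fun c => by
    ext n
    have : ⋃ k, (c (![i, j] k) n : Set I) = (c i n : Set I) ∪ c j n := by
      ext t; simp [Fin.exists_fin_two]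
    rw [Set.mem_ofPred_eq, Set.mem_ofPred_eq, this]
  rw [h0 a, h0 b]
  exact this

theorem Matched.eq_zero (h : Matched closedsLanguage E a b) (j : J) :
    E {n | (a j n : Set I) = {0}} {n | (b j n : Set I) = {0}} := by
  have := h.rel (k := 1) (2 : Fin 3) fun _ => j
  have h0 : ∀ c : J → ℕ → TopologicalSpace.Closeds I,
      {n | (c j n : Set I) = {0}} = {n | ∀ _ : Fin 1, (c j n : Set I) = {0}} := fun c => by
    simp
  rw [h0 a, h0 b]
  exact this

theorem Matched.nonempty_biInter_remTrace (hE : ModFiniteIso E)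
    (h : Matched closedsLanguage E a b) (s : Finset J) :
    (⋂ j ∈ s, remTrace (ofSlices (a j))).Nonempty ↔
      (⋂ j ∈ s, remTrace (ofSlices (b j))).Nonempty := by
  have key : ∀ c : J → ℕ → TopologicalSpace.Closeds I,
      (⋂ j ∈ s, remTrace (ofSlices (c j))).Nonempty ↔
        ¬ {n | ⋂ j ∈ s, (c j n : Set I) = ∅}ᶜ.Finite := by
    intro c
    rw [← remTrace_biInter s fun j => isClosed_ofSlices (c j), Set.nonempty_iff_ne_empty, ne_eq,
      remTrace_eq_empty_iff_finite_image_fst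
        (isClosed_iInter fun j => isClosed_iInter fun _ => isClosed_ofSlices (c j))]
    have : Prod.fst '' (⋂ j ∈ s, ofSlices (c j)) = {n | ⋂ j ∈ s, (c j n : Set I) = ∅}ᶜ := by
      ext n
      simp only [Set.mem_image, Set.mem_compl_iff, Set.mem_ofPred_eq, ← ne_eq,
        ← Set.nonempty_iff_ne_empty]
      constructor
      · rintro ⟨⟨m, t⟩, hz, rfl⟩
        exact ⟨t, by simpa [ofSlices] using hz⟩
      · rintro ⟨t, ht⟩
        exact ⟨(n, t), by simpa [ofSlices] using ht, rfl⟩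
    rw [this]
  rw [key a, key b, hE.finite_iff (hE.compl (h.inter_eq_empty s))]

theorem remTrace_union_eq_univ {F G : ℕ → TopologicalSpace.Closeds I}
    (h : ∀ᶠ n in Filter.cofinite, (F n : Set I) ∪ G n = Set.univ) :
    remTrace (ofSlices F) ∪ remTrace (ofSlices G) = Set.univ := by
  rw [← remTrace_union, ← Set.univ_subset_iff, ← remTrace_univ]
  refine remTrace_subset_of_cofinite (h.mono fun n hn t _ => ?_)
  have : t ∈ (F n : Set I) ∪ G n := hn ▸ Set.mem_univ t
  exact this

theorem Matched.remTrace_union_eq_univ (hE : ModFiniteIso E)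
    (h : Matched closedsLanguage E a b) {i j : J}
    (hij : ofSlices (a i) ∪ ofSlices (a j) = Set.univ) :
    remTrace (ofSlices (a i)) ∪ remTrace (ofSlices (a j)) = Set.univ ∧
      remTrace (ofSlices (b i)) ∪ remTrace (ofSlices (b j)) = Set.univ := by
  refine ⟨by rw [← remTrace_union, hij, remTrace_univ], _root_.remTrace_union_eq_univ ?_⟩
  refine (hE.finite_iff (hE.compl (h.union_eq_univ i j))).1 ?_
  convert Set.finite_empty
  rw [Set.compl_empty_iff, Set.eq_univ_iff_forall]
  refine fun n => Set.eq_univ_of_forall fun t => ?_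
  have : ((n, t) : MSpace) ∈ ofSlices (a i) ∪ ofSlices (a j) := hij ▸ Set.mem_univ _
  exact this

/-- Traces of closed sets separate the points of `𝕄*`, by pairs that cover `𝕄*` on both sides of a
matching. -/
theorem Matched.exists_separating_cover (hE : ModFiniteIso E)
    (h : Matched closedsLanguage E a b) (ha : Function.Surjective a) {x y : Remainder MSpace}
    (hxy : x ≠ y) :
    ∃ i j, x ∉ remTrace (ofSlices (a i)) ∧ y ∉ remTrace (ofSlices (a j)) ∧
      remTrace (ofSlices (a i)) ∪ remTrace (ofSlices (a j)) = Set.univ ∧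
      remTrace (ofSlices (b i)) ∪ remTrace (ofSlices (b j)) = Set.univ := by
  obtain ⟨F, G, hF, hG, hFG, h1, h2⟩ := exists_remTrace_cover_of_disjoint
    (isClosed_singleton (x := x)) (isClosed_singleton (x := y)) (by simpa using hxy)
  obtain ⟨SF, rfl⟩ := exists_ofSlices_eq hF
  obtain ⟨SG, rfl⟩ := exists_ofSlices_eq hG
  obtain ⟨i, rfl⟩ := ha SF
  obtain ⟨j, rfl⟩ := ha SG
  exact ⟨i, j, fun hx => Set.disjoint_left.1 h1 hx rfl, fun hy => Set.disjoint_left.1 h2 hy rfl,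
    h.remTrace_union_eq_univ hE hFG⟩

theorem Matched.exists_homeomorph (hE : ModFiniteIso E) (h : Matched closedsLanguage E a b)
    (ha : Function.Surjective a) (hb : Function.Surjective b) :
    ∃ H : Remainder MSpace ≃ₜ Remainder MSpace, ∀ p j,
      H p ∈ remTrace (ofSlices (b j)) ↔ p ∈ remTrace (ofSlices (a j)) :=
  exists_homeomorph_of_matching_closed (fun _ => isClosed_remTrace _)
    (fun _ => isClosed_remTrace _) (h.nonempty_biInter_remTrace hE)
    (fun _ _ hxy => h.exists_separating_cover hE ha hxy)
    (fun _ _ hxy => by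
      obtain ⟨i, j, h1, h2, h3, h4⟩ := h.flip.exists_separating_cover hE.flip hb hxy
      exact ⟨i, j, h1, h2, h4, h3⟩)

end MatchedCloseds

/-! ### The lifted autohomeomorphism -/

/-- `H` lifts `h`: a sequence matched with the slices of `A × [0,1]` has nonempty terms, modulo a
finite set, only on the set `B` that corresponds to `A`, so `H` maps the part of `𝕄*` over `A` into
the part over `B`. -/
theorem Matched.comp_piStar {h : Remainder ℕ ≃ₜ Remainder ℕ} {J : Type}
    {a b : J → ℕ → TopologicalSpace.Closeds I} (hab : Matched closedsLanguage (dualRel h) a b)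
    (ha : Function.Surjective a) {H : Remainder MSpace ≃ₜ Remainder MSpace}
    (hH : ∀ p j, H p ∈ remTrace (ofSlices (b j)) ↔ p ∈ remTrace (ofSlices (a j)))
    (p : Remainder MSpace) : piStar (H p) = h (piStar p) := by
  classical
  have hE := modFiniteIso_dualRel h
  symm
  refine eq_of_forall_mem_remTrace fun B hB => ?_
  obtain ⟨A, hA⟩ := hE.surj B
  obtain ⟨j, hj⟩ := ha fun n => if n ∈ A then ⊤ else ⊥
  have hslice : ofSlices (a j) = Prod.fst ⁻¹' A := by
    ext z
    change z.2 ∈ a j z.1 ↔ z.1 ∈ A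
    by_cases hz : z.1 ∈ A
    · simp only [hj, hz, iff_true]
      exact trivial
    · simp only [hj, hz, iff_false]
      exact id
  have hHp : H p ∈ remTrace (ofSlices (b j)) := by
    rw [hH, hslice, mem_remTrace_preimage_fst]
    exact (hA _).1 hB
  -- The set of indices where the slice of `b j` is nonempty corresponds to `A`.
  have hne := hE.compl (hab.inter_eq_empty {j})
  have hne' : {n | ⋂ i ∈ ({j} : Finset J), (a i n : Set I) = ∅}ᶜ = A := by
    ext n
    have htop : (⊤ : TopologicalSpace.Closeds I) ≠ ⊥ := fun htb =>
      (htb ▸ trivial : (0 : I) ∈ (⊥ : TopologicalSpace.Closeds I))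
    by_cases hn : n ∈ A <;> simp [hj, hn, htop]
  rw [hne'] at hne
  have hsub : remTrace (ofSlices (b j)) ⊆
      remTrace (Prod.fst ⁻¹' {n | ⋂ i ∈ ({j} : Finset J), (b i n : Set I) = ∅}ᶜ) := by
    refine remTrace_mono fun z hz => ?_
    simp only [Finset.mem_singleton, Set.iInter_iInter_eq_left, Set.mem_preimage,
      Set.mem_compl_iff, Set.mem_ofPred_eq]
    exact Set.Nonempty.ne_empty ⟨z.2, hz⟩
  have h1 := mem_remTrace_preimage_fst.1 (hsub hHp)
  rw [← h.apply_symm_apply (piStar (H p)), hne, ← hA, h.apply_symm_apply] at h1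
  exact h1

theorem Matched.map_zeroPoint {E : Set ℕ → Set ℕ → Prop} (hE : ModFiniteIso E) {J : Type}
    {a b : J → ℕ → TopologicalSpace.Closeds I} (hab : Matched closedsLanguage E a b)
    (ha : Function.Surjective a) {H : Remainder MSpace ≃ₜ Remainder MSpace}
    (hH : ∀ p j, H p ∈ remTrace (ofSlices (b j)) ↔ p ∈ remTrace (ofSlices (a j)))
    (u : Remainder ℕ) : H (zeroPoint u) = zeroPoint (piStar (H (zeroPoint u))) := by
  obtain ⟨j, hj⟩ := ha fun _ => ⟨{0}, isClosed_singleton⟩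
  have hslice : ofSlices (a j) = {z : MSpace | z.2 = 0} := by
    rw [hj]; rfl
  have h1 : H (zeroPoint u) ∈ remTrace (ofSlices (b j)) := by
    rw [hH, hslice]; exact zeroPoint_mem_remTrace u
  have h2 : {n | (b j n : Set I) = {0}}ᶜ.Finite := by
    refine (hE.finite_iff (hE.compl (hab.eq_zero j))).1 ?_
    convert Set.finite_empty
    simp [hj]
  refine eq_zeroPoint_of_mem_remTrace (remTrace_subset_of_cofinite ?_ h1)
  filter_upwards [show ∀ᶠ n in Filter.cofinite, (b j n : Set I) = {0} from h2] with n hn t ht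
  have : t ∈ (b j n : Set I) := ht
  rw [hn] at this
  exact this

/-- The order `≤_u` is defined from the topology of `𝕀_u` and the point `0̄_u`, so a homeomorphism
that respects both, preserves it. -/
theorem orderPreserving_of_map_zeroPoint {h : Remainder ℕ ≃ₜ Remainder ℕ}
    {H : Remainder MSpace ≃ₜ Remainder MSpace} (hH : ∀ p, piStar (H p) = h (piStar p))
    (h0 : ∀ u, H (zeroPoint u) = zeroPoint (h u)) : OrderPreserving H := by
  have hmem : ∀ u p, H p ∈ fiber (h u) ↔ p ∈ fiber u := by
    intro u p
    change piStar (H p) = h u ↔ piStar p = u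
    rw [hH, h.injective.eq_iff]
  refine ⟨h.toEquiv, fun u => ?_, ?_⟩
  · refine Set.Subset.antisymm (Set.image_subset_iff.2 fun p hp => (hmem u p).2 hp) fun q hq => ?_
    obtain ⟨p, rfl⟩ := H.surjective q
    exact ⟨p, (hmem u p).1 hq, rfl⟩
  · rintro u x y ⟨hx, hy, hxy⟩
    refine ⟨(hmem u x).2 hx, (hmem u y).2 hy, fun K hK hKc hKconn hyK h0K => ?_⟩
    refine hxy (H ⁻¹' K) (fun p hp => (hmem u p).1 (hK hp)) (H.isCompact_preimage.2 hKc)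
      (H.isConnected_preimage.2 hKconn) hyK ?_
    change H (zeroPoint u) ∈ K
    rw [h0]
    exact h0K

theorem theorem1
    (CH : (Cardinal.aleph 1 : Cardinal.{0}) = Cardinal.continuum)
    (h : Remainder ℕ ≃ₜ Remainder ℕ) :
    ∃ H : Remainder MSpace ≃ₜ Remainder MSpace,
      piStar ∘ H = h ∘ piStar ∧ OrderPreserving H := by
  have hE := modFiniteIso_dualRel h
  obtain ⟨J, a, b, hab, ha, hb⟩ :=
    exists_matched_enumeration (L := closedsLanguage) CH mk_closeds_le_continuum hE
  obtain ⟨H, hH⟩ := hab.exists_homeomorph hE ha hb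
  have hπ := hab.comp_piStar ha hH
  refine ⟨H, funext hπ, orderPreserving_of_map_zeroPoint hπ fun u => ?_⟩
  rw [hab.map_zeroPoint hE ha hH u, hπ, show piStar (zeroPoint u) = u from zeroPoint_mem_fiber u]
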